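/- Let $n,p\ge 0$ be integers and let $A:[0,\infty)\to\mathbb R^{n\times n}$ and $C:[0,\infty)\to\mathbb R^{p\times n}$ be continuous and uniformly bounded. Let $\|\cdot\|$ denote the Euclidean norm and the induced matrix norm. For a coefficient matrix $F:[0,\infty)\to\mathbb R^{n\times n}$ that is bounded and measurable, a fundamental matrix of $\dot x=F(t)x$ is a solution $X:[0,\infty)\to\mathbb R^{n\times n}$ of $\dot X=F(t)X$ with nonsingular values (in the sense of the integrated equation $X(t)=X(0)+\int_0^tF(s)X(s)\,ds$, which is the classical sense if $F$ is continuous), and $\Phi_F(t,t_0)=X(t)X(t_0)^{-1}$ is the state transition matrix, which is independent of the choice of $X$. Suppose that $\dot x=A(t)x$ is anti-stable, i.e. admits an exponential dichotomy on $[0,\infty)$ with projection $P=0$: for some fundamental matrix $X$ there are constants $K\ge 1$ and $\alpha>0$ with $$\|X(t)X(t_0)^{-1}\|\le K e^{\alpha(t-t_0)}\qquad\text{for all } 0\le t\le t_0.$$ Then the following two properties are equivalent. (i) $(A,C)$ is uniformly exponentially detectable: there is a uniformly bounded, measurable matrix function $L:[0,\infty)\to\mathbb R^{n\times p}$ such that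 $\dot e=[A(t)-L(t)C(t)]e$ is uniformly exponentially stable, i.e. there are $K_e\ge 1$ and $\mu>0$ with $\|\Phi_{A-LC}(t,t_0)\|\le K_e e^{-\mu(t-t_0)}$ for all $t\ge t_0\ge 0$. (ii) $(A,C)$ is uniformly completely observable: there are constants $\beta_1,\beta_2,\sigma>0$ such that $$\beta_1 I_n\preceq \int_{t_0}^{t_0+\sigma}\Phi_A(s,t_0)^{\top}C(s)^{\top}C(s)\Phi_A(s,t_0)\,ds\preceq\beta_2 I_n\qquad\text{for all } t_0\ge 0,$$ where $\preceq$ is the order of symmetric matrices given by positive semidefiniteness of the difference. -/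

import Mathlib

open MeasureTheory Set
open scoped Matrix Matrix.Norms.L2Operator

namespace LTV

/-- `X` is a fundamental matrix solution of `ẋ = A(t) x` on `[0, ∞)`: it takes nonsingular values
and solves `Ẋ = A(t) X` in the sense of Carathéodory, i.e. it satisfies the integrated equation
(with an integrable integrand). If `A` is continuous, these are the classical
continuously differentiable nonsingular solutions; the integrated form also makes sense for the
merely bounded and measurable coefficients of observer error systems. -/
def IsFundamentalMatrix {n : ℕ} (A X : ℝ → Matrix (Fin n) (Fin n) ℝ) : Prop :=
  ∀ t, 0 ≤ t →
    IsUnit (X t) ∧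
    IntervalIntegrable (fun s => A s * X s) volume 0 t ∧
    X t = X 0 + ∫ s in (0 : ℝ)..t, A s * X s

/-- The state transition matrix `Φ(t, t₀) = X(t) X(t₀)⁻¹` formed from a fundamental matrix `X`;
it does not depend on the choice of `X`. -/
noncomputable def transition {n : ℕ} (X : ℝ → Matrix (Fin n) (Fin n) ℝ) (t t₀ : ℝ) :
    Matrix (Fin n) (Fin n) ℝ :=
  X t * (X t₀)⁻¹

/-- A matrix function is uniformly bounded on `[0, ∞)`, in the norm induced by the Euclidean
vector norms. -/
def UniformlyBounded {m k : ℕ} (F : ℝ → Matrix (Fin m) (Fin k) ℝ) : Prop :=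
  ∃ b : ℝ, ∀ t, 0 ≤ t → ‖F t‖ ≤ b

/-- Uniform exponential stability of `ẋ = A(t) x` on `[0, ∞)`. -/
def UniformlyExponentiallyStable {n : ℕ} (A : ℝ → Matrix (Fin n) (Fin n) ℝ) : Prop :=
  ∃ X, IsFundamentalMatrix A X ∧
    ∃ K μ : ℝ, 1 ≤ K ∧ 0 < μ ∧
      ∀ t₀ t, 0 ≤ t₀ → t₀ ≤ t → ‖transition X t t₀‖ ≤ K * Real.exp (-μ * (t - t₀))

/-- Uniform exponential detectability of `(A, C)`: some uniformly bounded (measurable) output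
injection gain `L` makes the error system `ė = (A(t) - L(t) C(t)) e` uniformly exponentially
stable. -/
def UniformlyExponentiallyDetectable {n p : ℕ} (A : ℝ → Matrix (Fin n) (Fin n) ℝ)
    (C : ℝ → Matrix (Fin p) (Fin n) ℝ) : Prop :=
  ∃ L : ℝ → Matrix (Fin n) (Fin p) ℝ,
    AEStronglyMeasurable L (volume.restrict (Ici 0)) ∧ UniformlyBounded L ∧
      UniformlyExponentiallyStable (fun t => A t - L t * C t)

/-- `ẋ = A(t) x` admits an exponential dichotomy on `[0, ∞)` with projection matrix `P`. -/
def HasExponentialDichotomy {n : ℕ} (A : ℝ → Matrix (Fin n) (Fin n) ℝ)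
    (P : Matrix (Fin n) (Fin n) ℝ) : Prop :=
  P * P = P ∧ ∃ X, IsFundamentalMatrix A X ∧
    ∃ K α : ℝ, 1 ≤ K ∧ 0 < α ∧
      (∀ t t₀, 0 ≤ t₀ → t₀ ≤ t → ‖X t * P * (X t₀)⁻¹‖ ≤ K * Real.exp (-α * (t - t₀))) ∧
      (∀ t t₀, 0 ≤ t → t ≤ t₀ → ‖X t * (1 - P) * (X t₀)⁻¹‖ ≤ K * Real.exp (α * (t - t₀)))

/-- The observability Gramian
`M(t₁, t₀) = ∫_{t₀}^{t₁} Φ(s, t₀)ᵀ C(s)ᵀ C(s) Φ(s, t₀) ds`, where `Φ` is formed from the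
fundamental matrix `X`. -/
noncomputable def observabilityGramian {n p : ℕ} (X : ℝ → Matrix (Fin n) (Fin n) ℝ)
    (C : ℝ → Matrix (Fin p) (Fin n) ℝ) (t₁ t₀ : ℝ) : Matrix (Fin n) (Fin n) ℝ :=
  ∫ s in t₀..t₁, (transition X s t₀)ᵀ * (C s)ᵀ * C s * transition X s t₀

/-- Uniform complete observability of `(A, C)`: `β₁ I ⪯ M(t₀ + σ, t₀) ⪯ β₂ I` for all `t₀ ≥ 0`. -/
def UniformlyCompletelyObservable {n p : ℕ} (A : ℝ → Matrix (Fin n) (Fin n) ℝ)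
    (C : ℝ → Matrix (Fin p) (Fin n) ℝ) : Prop :=
  ∃ X, IsFundamentalMatrix A X ∧
    ∃ β₁ β₂ σ : ℝ, 0 < β₁ ∧ 0 < β₂ ∧ 0 < σ ∧
      ∀ t₀, 0 ≤ t₀ →
        (observabilityGramian X C (t₀ + σ) t₀ - β₁ • 1).PosSemidef ∧
        (β₂ • 1 - observabilityGramian X C (t₀ + σ) t₀).PosSemidef

end LTV

/-!
For the plant `ẋ = A(t) x`, with transition matrix `Φ`, anti-stability means that solutions decay
exponentially backwards in time and, equivalently, grow exponentially forwards.

*Detectability implies observability.* A solution `x` of the plant also solves the error system with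
the input `L C x`, hence `‖x(t₀ + σ)‖ ≤ Kₑ ‖x(t₀)‖ + Kₑ l ∫ ‖C x‖` over `[t₀, t₀ + σ]`
(`norm_le_of_output_injection`). For a long window, anti-stability forces
`‖x(t₀ + σ)‖ ≥ (Kₑ + 1) ‖x(t₀)‖`, so the output energy over the window is at least a fixed multiple
of `‖x(t₀)‖²`. The estimate is obtained without a variation of constants formula, from the difference
quotients of the norm of `s ↦ Φₑ(t, s) x(s)`, with `Φₑ` the transition matrix of the error system;
these are controlled although `L` is merely measurable.

*Observability implies detectability.* Let `X` be a fundamental matrix of the plant and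
`W(t) = Φ(0, t)ᵀ Φ(0, t) + ∫₀ᵗ Φ(s, t)ᵀ C(s)ᵀ C(s) Φ(s, t) ds`. Anti-stability bounds `W` from above
(`norm_backwardGramian_le`), uniform observability bounds it from below by a positive constant
(`backwardGramian_coercive`), and `W' = -Aᵀ W - W A + Cᵀ C`. With the gain `L = W⁻¹ Cᵀ`, a solution
`e` of the error system satisfies `(W e)' = -Aᵀ (W e)`, the adjoint equation of the plant, which is
exponentially stable because the plant is anti-stable. In terms of `G = Xᵀ W X`, which satisfies
`G' = Xᵀ Cᵀ C X`, a fundamental matrix of the error system is `X G⁻¹`, and its transition matrix is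
`W(t)⁻¹ Φ(t₀, t)ᵀ W(t₀)`.
-/

namespace LTV

/-! ### Matrices acting on Euclidean vectors -/

/-- The action of matrices on Euclidean vectors as a continuous bilinear map, so that continuity,
differentiation and integration of matrix functions pass to their values at a vector. -/
noncomputable def mulVecBilin (m k : ℕ) :
    Matrix (Fin m) (Fin k) ℝ →L[ℝ] EuclideanSpace ℝ (Fin k) →L[ℝ] EuclideanSpace ℝ (Fin m) :=
  LinearMap.mkContinuous₂
    (LinearMap.mk₂ ℝ (fun (M : Matrix (Fin m) (Fin k) ℝ) (v : EuclideanSpace ℝ (Fin k)) =>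
        (WithLp.toLp 2 (M *ᵥ v.ofLp) : EuclideanSpace ℝ (Fin m)))
      (fun M N v => by simp [Matrix.add_mulVec])
      (fun c M v => by simp [Matrix.smul_mulVec])
      (fun M v w => by simp [Matrix.mulVec_add])
      (fun c M v => by simp [Matrix.mulVec_smul]))
    1 (fun M v => by simpa using! Matrix.l2_opNorm_mulVec M v)

/-- `act M v` is the Euclidean vector `M v`. -/
noncomputable abbrev act {m k : ℕ} (M : Matrix (Fin m) (Fin k) ℝ) (v : EuclideanSpace ℝ (Fin k)) :
    EuclideanSpace ℝ (Fin m) :=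
  mulVecBilin m k M v

lemma act_eq {m k : ℕ} (M : Matrix (Fin m) (Fin k) ℝ) (v : EuclideanSpace ℝ (Fin k)) :
    act M v = WithLp.toLp 2 (M *ᵥ v.ofLp) := rfl

lemma norm_act_le {m k : ℕ} (M : Matrix (Fin m) (Fin k) ℝ) (v : EuclideanSpace ℝ (Fin k)) :
    ‖act M v‖ ≤ ‖M‖ * ‖v‖ :=
  Matrix.l2_opNorm_mulVec M v

lemma norm_act_le_of_le {m k : ℕ} {M : Matrix (Fin m) (Fin k) ℝ} {b : ℝ} (h : ‖M‖ ≤ b)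
    (v : EuclideanSpace ℝ (Fin k)) : ‖act M v‖ ≤ b * ‖v‖ :=
  (norm_act_le M v).trans (mul_le_mul_of_nonneg_right h (norm_nonneg v))

lemma act_mul {m k l : ℕ} (M : Matrix (Fin m) (Fin k) ℝ) (N : Matrix (Fin k) (Fin l) ℝ)
    (v : EuclideanSpace ℝ (Fin l)) : act (M * N) v = act M (act N v) := by
  simp [act_eq, Matrix.mulVec_mulVec]

lemma act_one {m : ℕ} (v : EuclideanSpace ℝ (Fin m)) :
    act (1 : Matrix (Fin m) (Fin m) ℝ) v = v := by
  simp [act_eq]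

lemma act_sub_left {m k : ℕ} (M N : Matrix (Fin m) (Fin k) ℝ) (v : EuclideanSpace ℝ (Fin k)) :
    act (M - N) v = act M v - act N v := by
  simp [act]

lemma act_sub_right {m k : ℕ} (M : Matrix (Fin m) (Fin k) ℝ) (v w : EuclideanSpace ℝ (Fin k)) :
    act M (v - w) = act M v - act M w :=
  map_sub _ _ _

lemma opNorm_le_of_norm_act_le {m k : ℕ} {M : Matrix (Fin m) (Fin k) ℝ} {b : ℝ} (hb : 0 ≤ b)
    (h : ∀ v, ‖act M v‖ ≤ b * ‖v‖) : ‖M‖ ≤ b := by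
  rw [Matrix.l2_opNorm_def]
  exact ContinuousLinearMap.opNorm_le_bound _ hb h

lemma inner_act_transpose_mul_self {m k : ℕ} (M : Matrix (Fin m) (Fin k) ℝ)
    (v : EuclideanSpace ℝ (Fin k)) : inner ℝ v (act (Mᵀ * M) v) = ‖act M v‖ ^ 2 := by
  rw [← real_inner_self_eq_norm_sq, act_mul]
  simp only [EuclideanSpace.inner_eq_star_dotProduct, act_eq, star_trivial]
  rw [Matrix.mulVec_transpose, ← Matrix.dotProduct_mulVec]

lemma norm_transpose {m k : ℕ} (M : Matrix (Fin m) (Fin k) ℝ) : ‖Mᵀ‖ = ‖M‖ := by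
  rw [← Matrix.conjTranspose_eq_transpose_of_trivial, Matrix.l2_opNorm_conjTranspose]

lemma norm_one_le {n : ℕ} : ‖(1 : Matrix (Fin n) (Fin n) ℝ)‖ ≤ 1 :=
  opNorm_le_of_norm_act_le zero_le_one fun v => by rw [act_one, one_mul]

lemma posSemidef_of_inner_nonneg {n : ℕ} {M : Matrix (Fin n) (Fin n) ℝ} (hM : Mᵀ = M)
    (h : ∀ v, 0 ≤ inner ℝ v (act M v)) : M.PosSemidef := by
  refine .of_dotProduct_mulVec_nonneg ?_ fun x => ?_
  · rwa [Matrix.IsHermitian, Matrix.conjTranspose_eq_transpose_of_trivial]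
  · have := h (WithLp.toLp 2 x)
    rwa [EuclideanSpace.inner_eq_star_dotProduct, act_eq, dotProduct_comm, star_trivial] at this

lemma inner_act_nonneg {n : ℕ} {M : Matrix (Fin n) (Fin n) ℝ} (hM : M.PosSemidef)
    (v : EuclideanSpace ℝ (Fin n)) : 0 ≤ inner ℝ v (act M v) := by
  have := hM.dotProduct_mulVec_nonneg v.ofLp
  rwa [EuclideanSpace.inner_eq_star_dotProduct, act_eq, dotProduct_comm, star_trivial]

lemma _root_.ContinuousOn.matrix_mul_rect {m k l : ℕ} {f : ℝ → Matrix (Fin m) (Fin k) ℝ}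
    {g : ℝ → Matrix (Fin k) (Fin l) ℝ} {s : Set ℝ} (hf : ContinuousOn f s)
    (hg : ContinuousOn g s) : ContinuousOn (fun t => f t * g t) s := by
  have h : Continuous fun q : Matrix (Fin m) (Fin k) ℝ × Matrix (Fin k) (Fin l) ℝ => q.1 * q.2 :=
    continuous_fst.matrix_mul continuous_snd
  exact h.comp_continuousOn (hf.prodMk hg)

lemma _root_.ContinuousOn.matrix_transpose_on {m k : ℕ} {f : ℝ → Matrix (Fin m) (Fin k) ℝ}
    {s : Set ℝ} (hf : ContinuousOn f s) : ContinuousOn (fun t => (f t)ᵀ) s :=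
  (continuous_id.matrix_transpose).comp_continuousOn hf

lemma _root_.ContinuousOn.act {m k : ℕ} {f : ℝ → Matrix (Fin m) (Fin k) ℝ}
    {g : ℝ → EuclideanSpace ℝ (Fin k)} {s : Set ℝ} (hf : ContinuousOn f s)
    (hg : ContinuousOn g s) : ContinuousOn (fun t => act (f t) (g t)) s :=
  ((mulVecBilin m k).continuous.comp_continuousOn hf).clm_apply hg

lemma hasDerivWithinAt_matrix_inv {n : ℕ} {G : ℝ → Matrix (Fin n) (Fin n) ℝ}
    {G' : Matrix (Fin n) (Fin n) ℝ} {s : Set ℝ} {t : ℝ} (hG : HasDerivWithinAt G G' s t)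
    (hu : IsUnit (G t)) :
    HasDerivWithinAt (fun r => (G r)⁻¹) (-((G t)⁻¹ * G' * (G t)⁻¹)) s t := by
  obtain ⟨u, hu⟩ := hu
  have h := hasFDerivAt_ringInverse (𝕜 := ℝ) u
  rw [hu] at h
  have h2 := h.comp_hasDerivWithinAt t hG
  have e : (↑u⁻¹ : Matrix (Fin n) (Fin n) ℝ) = (G t)⁻¹ := by
    rw [← hu, Matrix.coe_units_inv]
  simp only [Matrix.nonsing_inv_eq_ringInverse] at e ⊢
  rw [e] at h2
  simpa [Function.comp_def] using h2

lemma continuousOn_matrix_inv {n : ℕ} {G : ℝ → Matrix (Fin n) (Fin n) ℝ} {s : Set ℝ}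
    (hG : ContinuousOn G s) (hu : ∀ t ∈ s, IsUnit (G t)) : ContinuousOn (fun t => (G t)⁻¹) s := by
  intro t ht
  obtain ⟨u, hu⟩ := hu t ht
  have h : ContinuousAt Ring.inverse (G t) := hu ▸ NormedRing.inverse_continuousAt u
  simpa only [Matrix.nonsing_inv_eq_ringInverse, Function.comp_def] using
    h.comp_continuousWithinAt (hG t ht)

lemma inv_mul_self_of_isUnit {n : ℕ} {M : Matrix (Fin n) (Fin n) ℝ} (h : IsUnit M) :
    M⁻¹ * M = 1 :=
  Matrix.nonsing_inv_mul _ ((Matrix.isUnit_iff_isUnit_det _).1 h)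

lemma mul_inv_self_of_isUnit {n : ℕ} {M : Matrix (Fin n) (Fin n) ℝ} (h : IsUnit M) :
    M * M⁻¹ = 1 :=
  Matrix.mul_nonsing_inv _ ((Matrix.isUnit_iff_isUnit_det _).1 h)

/-! ### Calculus on the half-line -/

lemma _root_.ContinuousOn.intervalIntegrable_Ici {E : Type*} [NormedAddCommGroup E]
    {g : ℝ → E} (hg : ContinuousOn g (Ici 0)) {a b : ℝ} (ha : 0 ≤ a) (hb : 0 ≤ b) :
    IntervalIntegrable g volume a b :=
  (hg.mono fun _ hx => (le_min ha hb).trans hx.1).intervalIntegrable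

/-- The fundamental theorem of calculus on `[0, ∞)`, with the one-sided derivative at `0`. -/
lemma hasDerivWithinAt_integral_Ici {E : Type*} [NormedAddCommGroup E] [NormedSpace ℝ E]
    [CompleteSpace E] {g : ℝ → E} (hg : ContinuousOn g (Ici 0)) {t : ℝ} (ht : 0 ≤ t) :
    HasDerivWithinAt (fun r => ∫ s in (0 : ℝ)..r, g s) (g t) (Ici 0) t := by
  -- `g` is replaced by its extension by `g 0`, which is continuous on the whole line
  have hc : Continuous fun r : ℝ => g (max r 0) :=
    hg.comp_continuous (by fun_prop) fun r => le_max_right r 0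
  have h := (hc.integral_hasStrictDerivAt 0 t).hasDerivAt.hasDerivWithinAt (s := Ici 0)
  rw [max_eq_left ht] at h
  have e : ∀ r ∈ Ici (0 : ℝ), (∫ s in (0 : ℝ)..r, g s) = ∫ s in (0 : ℝ)..r, g (max s 0) := by
    intro r hr
    refine intervalIntegral.integral_congr fun s hs => ?_
    rw [uIcc_of_le hr] at hs
    simp only [max_eq_left hs.1]
  exact h.congr e (e t ht)

/-- Grönwall's inequality for the homogeneous linear equation. -/
lemma norm_le_exp_mul_of_hasDerivWithinAt {n : ℕ} {A Z : ℝ → Matrix (Fin n) (Fin n) ℝ} {a : ℝ}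
    (hA : ∀ t, 0 ≤ t → ‖A t‖ ≤ a)
    (hZ : ∀ t, 0 ≤ t → HasDerivWithinAt Z (A t * Z t) (Ici 0) t) {s t : ℝ} (hs : 0 ≤ s)
    (hst : s ≤ t) : ‖Z t‖ ≤ ‖Z s‖ * Real.exp (a * (t - s)) := by
  rw [← gronwallBound_ε0]
  refine norm_le_gronwallBound_of_norm_deriv_right_le (f' := fun r => A r * Z r) (b := t) ?_ ?_
    le_rfl ?_ t ⟨hst, le_rfl⟩
  · exact fun r hr => ((hZ r (hs.trans hr.1)).continuousWithinAt).mono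
      fun x hx => hs.trans hx.1
  · exact fun r hr => (hZ r (hs.trans hr.1)).mono fun x hx => (hs.trans hr.1).trans hx
  · intro r hr
    rw [add_zero]
    exact (norm_mul_le _ _).trans
      (mul_le_mul_of_nonneg_right (hA r (hs.trans hr.1)) (norm_nonneg _))

/-! ### Fundamental matrices -/

lemma IsFundamentalMatrix.continuousOn {n : ℕ} {A X : ℝ → Matrix (Fin n) (Fin n) ℝ}
    (hX : IsFundamentalMatrix A X) : ContinuousOn X (Ici 0) := by
  intro t ht
  have ht : 0 ≤ t := ht
  have hI := (hX (t + 1) (by linarith)).2.1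
  have h := intervalIntegral.continuousOn_primitive_interval
    ((intervalIntegrable_iff' enorm_ne_top).1 hI)
  rw [uIcc_of_le (by linarith)] at h
  have h1 : ContinuousWithinAt X (Icc 0 (t + 1)) t :=
    ((continuousOn_const (c := X 0)).add h t ⟨ht, by linarith⟩).congr
      (fun r hr => (hX r hr.1).2.2) (hX t ht).2.2
  refine h1.mono_of_mem_nhdsWithin ?_
  filter_upwards [self_mem_nhdsWithin, mem_nhdsWithin_of_mem_nhds (Iio_mem_nhds (lt_add_one t))]
    with r hr hr' using ⟨hr, le_of_lt hr'⟩

lemma IsFundamentalMatrix.intervalIntegrable {n : ℕ} {A X : ℝ → Matrix (Fin n) (Fin n) ℝ}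
    (hX : IsFundamentalMatrix A X) {s t : ℝ} (hs : 0 ≤ s) (ht : 0 ≤ t) :
    IntervalIntegrable (fun r => A r * X r) volume s t :=
  (hX s hs).2.1.symm.trans (hX t ht).2.1

lemma IsFundamentalMatrix.sub_eq_integral {n : ℕ} {A X : ℝ → Matrix (Fin n) (Fin n) ℝ}
    (hX : IsFundamentalMatrix A X) {s t : ℝ} (hs : 0 ≤ s) (ht : 0 ≤ t) :
    X t - X s = ∫ r in s..t, A r * X r := by
  rw [(hX t ht).2.2, (hX s hs).2.2, add_sub_add_left_eq_sub,
    intervalIntegral.integral_interval_sub_left (hX t ht).2.1 (hX s hs).2.1]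

lemma IsFundamentalMatrix.hasDerivWithinAt {n : ℕ} {A X : ℝ → Matrix (Fin n) (Fin n) ℝ}
    (hX : IsFundamentalMatrix A X) (hA : ContinuousOn A (Ici 0)) {t : ℝ} (ht : 0 ≤ t) :
    HasDerivWithinAt X (A t * X t) (Ici 0) t :=
  ((hasDerivWithinAt_integral_Ici (hA.mul hX.continuousOn) ht).const_add (X 0)).congr
    (fun r hr => (hX r hr).2.2) (hX t ht).2.2

lemma isFundamentalMatrix_of_hasDerivWithinAt {n : ℕ} {A X : ℝ → Matrix (Fin n) (Fin n) ℝ}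
    (hA : ContinuousOn A (Ici 0)) (hu : ∀ t, 0 ≤ t → IsUnit (X t))
    (hX : ∀ t, 0 ≤ t → HasDerivWithinAt X (A t * X t) (Ici 0) t) : IsFundamentalMatrix A X := by
  have hc : ContinuousOn X (Ici 0) := fun t ht => (hX t ht).continuousWithinAt
  intro t ht
  have hi := (hA.mul hc).intervalIntegrable_Ici le_rfl ht
  refine ⟨hu t ht, hi, ?_⟩
  have h := intervalIntegral.integral_eq_sub_of_hasDeriv_right_of_le ht
    (hc.mono fun r hr => hr.1) (fun r hr => (hX r hr.1.le).mono fun x hx => ?_) hi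
  · exact (sub_eq_iff_eq_add'.1 h.symm)
  · exact hr.1.le.trans (le_of_lt hx)

lemma IsFundamentalMatrix.continuousOn_inv {n : ℕ} {A X : ℝ → Matrix (Fin n) (Fin n) ℝ}
    (hX : IsFundamentalMatrix A X) : ContinuousOn (fun t => (X t)⁻¹) (Ici 0) :=
  continuousOn_matrix_inv hX.continuousOn fun t ht => (hX t ht).1

lemma IsFundamentalMatrix.transition_self {n : ℕ} {A X : ℝ → Matrix (Fin n) (Fin n) ℝ}
    (hX : IsFundamentalMatrix A X) {t : ℝ} (ht : 0 ≤ t) : transition X t t = 1 :=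
  mul_inv_self_of_isUnit (hX t ht).1

lemma IsFundamentalMatrix.transition_mul {n : ℕ} {A X : ℝ → Matrix (Fin n) (Fin n) ℝ}
    (hX : IsFundamentalMatrix A X) {t s r : ℝ} (hs : 0 ≤ s) :
    transition X t s * transition X s r = transition X t r := by
  rw [transition, transition, Matrix.mul_assoc, ← Matrix.mul_assoc (X s)⁻¹,
    inv_mul_self_of_isUnit (hX s hs).1, Matrix.one_mul, transition]

lemma IsFundamentalMatrix.transition_mul_self {n : ℕ} {A X : ℝ → Matrix (Fin n) (Fin n) ℝ}
    (hX : IsFundamentalMatrix A X) {t s : ℝ} (hs : 0 ≤ s) :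
    transition X t s * X s = X t := by
  rw [transition, Matrix.mul_assoc, inv_mul_self_of_isUnit (hX s hs).1, Matrix.mul_one]

lemma IsFundamentalMatrix.continuousOn_transition {n : ℕ} {A X : ℝ → Matrix (Fin n) (Fin n) ℝ}
    (hX : IsFundamentalMatrix A X) (t₀ : ℝ) :
    ContinuousOn (fun t => transition X t t₀) (Ici 0) :=
  hX.continuousOn.mul continuousOn_const

lemma IsFundamentalMatrix.norm_transition_le {n : ℕ} {A X : ℝ → Matrix (Fin n) (Fin n) ℝ} {a : ℝ}
    (hX : IsFundamentalMatrix A X) (hA : ContinuousOn A (Ici 0)) (ha : ∀ t, 0 ≤ t → ‖A t‖ ≤ a)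
    {s t : ℝ} (hs : 0 ≤ s) (hst : s ≤ t) : ‖transition X t s‖ ≤ Real.exp (a * (t - s)) := by
  have h := norm_le_exp_mul_of_hasDerivWithinAt (Z := fun t => transition X t s) ha
    (fun r hr => by
      simpa [transition, Matrix.mul_assoc] using
        (hX.hasDerivWithinAt hA hr).mul_const ((X s)⁻¹)) hs hst
  simp only [hX.transition_self hs] at h
  exact h.trans (mul_le_of_le_one_left (Real.exp_pos _).le norm_one_le)

/-- The state transition matrix does not depend on the choice of the fundamental matrix. -/
lemma IsFundamentalMatrix.transition_eq {n : ℕ} {A X Y : ℝ → Matrix (Fin n) (Fin n) ℝ} {a : ℝ}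
    (hX : IsFundamentalMatrix A X) (hY : IsFundamentalMatrix A Y) (hA : ContinuousOn A (Ici 0))
    (ha : ∀ t, 0 ≤ t → ‖A t‖ ≤ a) {s t : ℝ} (hs : 0 ≤ s) (hst : s ≤ t) :
    transition X t s = transition Y t s := by
  have h := norm_le_exp_mul_of_hasDerivWithinAt
    (Z := fun t => transition X t s - transition Y t s) ha
    (fun r hr => by
      simpa [transition, Matrix.mul_assoc, Matrix.mul_sub] using
        ((hX.hasDerivWithinAt hA hr).mul_const ((X s)⁻¹)).fun_sub
          ((hY.hasDerivWithinAt hA hr).mul_const ((Y s)⁻¹))) hs hst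
  simp only [hX.transition_self hs, hY.transition_self hs, sub_self, norm_zero, zero_mul] at h
  exact sub_eq_zero.1 (norm_le_zero_iff.1 h)

/-! ### The quadratic form of the observability Gramian -/

lemma inner_act_integral {n : ℕ} {F : ℝ → Matrix (Fin n) (Fin n) ℝ} {a b : ℝ}
    (hF : IntervalIntegrable F volume a b) (v : EuclideanSpace ℝ (Fin n)) :
    inner ℝ v (act (∫ s in a..b, F s) v) = ∫ s in a..b, inner ℝ v (act (F s) v) :=
  (((innerSL ℝ v).comp ((mulVecBilin n n).flip v)).intervalIntegral_comp_comm hF).symm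

lemma transpose_integral {n : ℕ} {F : ℝ → Matrix (Fin n) (Fin n) ℝ} {a b : ℝ}
    (hF : IntervalIntegrable F volume a b) :
    (∫ s in a..b, F s)ᵀ = ∫ s in a..b, (F s)ᵀ :=
  ((Matrix.transposeLinearEquiv (Fin n) (Fin n) ℝ ℝ).toLinearMap.toContinuousLinearMap
    |>.intervalIntegral_comp_comm hF).symm

lemma continuousOn_gram {n p : ℕ} {N : ℝ → Matrix (Fin n) (Fin n) ℝ}
    {C : ℝ → Matrix (Fin p) (Fin n) ℝ} {s : Set ℝ} (hN : ContinuousOn N s)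
    (hC : ContinuousOn C s) : ContinuousOn (fun t => (N t)ᵀ * (C t)ᵀ * C t * N t) s :=
  ((hN.matrix_transpose_on.matrix_mul_rect hC.matrix_transpose_on).matrix_mul_rect hC).mul hN

lemma inner_act_gram {n p : ℕ} (N : Matrix (Fin n) (Fin n) ℝ) (C : Matrix (Fin p) (Fin n) ℝ)
    (v : EuclideanSpace ℝ (Fin n)) :
    inner ℝ v (act (Nᵀ * Cᵀ * C * N) v) = ‖act C (act N v)‖ ^ 2 := by
  rw [← act_mul, ← inner_act_transpose_mul_self, Matrix.transpose_mul]
  simp only [Matrix.mul_assoc]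

lemma inner_act_integral_gram {n p : ℕ} {N : ℝ → Matrix (Fin n) (Fin n) ℝ}
    {C : ℝ → Matrix (Fin p) (Fin n) ℝ} (hN : ContinuousOn N (Ici 0)) (hC : ContinuousOn C (Ici 0))
    {a b : ℝ} (ha : 0 ≤ a) (hb : 0 ≤ b) (v : EuclideanSpace ℝ (Fin n)) :
    inner ℝ v (act (∫ s in a..b, (N s)ᵀ * (C s)ᵀ * C s * N s) v) =
      ∫ s in a..b, ‖act (C s) (act (N s) v)‖ ^ 2 := by
  rw [inner_act_integral ((continuousOn_gram hN hC).intervalIntegrable_Ici ha hb)]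
  simp only [inner_act_gram]

lemma transpose_integral_gram {n p : ℕ} {N : ℝ → Matrix (Fin n) (Fin n) ℝ}
    {C : ℝ → Matrix (Fin p) (Fin n) ℝ} (hN : ContinuousOn N (Ici 0)) (hC : ContinuousOn C (Ici 0))
    {a b : ℝ} (ha : 0 ≤ a) (hb : 0 ≤ b) :
    (∫ s in a..b, (N s)ᵀ * (C s)ᵀ * C s * N s)ᵀ = ∫ s in a..b, (N s)ᵀ * (C s)ᵀ * C s * N s := by
  rw [transpose_integral ((continuousOn_gram hN hC).intervalIntegrable_Ici ha hb)]
  simp only [Matrix.transpose_mul, Matrix.transpose_transpose, Matrix.mul_assoc]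

/-! ### Solutions of the plant as perturbed solutions of the error system -/

section Variation

variable {n p : ℕ} {A E : ℝ → Matrix (Fin n) (Fin n) ℝ} {C : ℝ → Matrix (Fin p) (Fin n) ℝ}
  {L : ℝ → Matrix (Fin n) (Fin p) ℝ} {x : ℝ → EuclideanSpace ℝ (Fin n)} {f l K : ℝ}

/-- A solution `x` of the plant leaves the solution of the error system that starts at `x s` with
speed at most `l ‖C x‖`. As `L` is merely measurable, there is no derivative to compute, only a
bound on the difference quotients. -/
lemma eventually_norm_sub_transition_le (hA : ContinuousOn A (Ici 0)) (hC : ContinuousOn C (Ici 0))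
    (hf : ∀ t, 0 ≤ t → ‖A t - L t * C t‖ ≤ f) (hl : ∀ t, 0 ≤ t → ‖L t‖ ≤ l)
    (hE : IsFundamentalMatrix (fun t => A t - L t * C t) E)
    (hx : ∀ t, 0 ≤ t → HasDerivWithinAt x (act (A t) (x t)) (Ici 0) t) {s r : ℝ} (hs : 0 ≤ s)
    (hr : l * ‖act (C s) (x s)‖ < r) :
    ∀ᶠ z in nhdsWithin s (Ioi s), ‖x z - act (transition E z s) (x s)‖ ≤ r * (z - s) := by
  have hxc : ContinuousOn x (Ici 0) := fun t ht => (hx t ht).continuousWithinAt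
  set y : ℝ → EuclideanSpace ℝ (Fin n) := fun z => act (transition E z s) (x s) with hy
  have hyc : ContinuousOn y (Ici 0) := (hE.continuousOn_transition s).act continuousOn_const
  have hys : y s = x s := by simp only [hy, hE.transition_self hs, act_one]
  have hyint : ∀ z, 0 ≤ z →
      IntervalIntegrable (fun t => act (A t - L t * C t) (y t)) volume s z ∧
      y z - y s = ∫ t in s..z, act (A t - L t * C t) (y t) := by
    intro z hz
    have hi := hE.intervalIntegrable hs hz
    let ev : Matrix (Fin n) (Fin n) ℝ →L[ℝ] EuclideanSpace ℝ (Fin n) :=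
      (mulVecBilin n n).flip (act (E s)⁻¹ (x s))
    have e : ∀ M : Matrix (Fin n) (Fin n) ℝ, ev M = act (M * (E s)⁻¹) (x s) := fun M =>
      (act_mul _ _ _).symm
    have e2 : (fun t => ev ((A t - L t * C t) * E t)) = fun t => act (A t - L t * C t) (y t) := by
      funext t
      rw [e, hy, ← act_mul, transition, Matrix.mul_assoc]
    constructor
    · rw [← e2]
      exact ⟨ev.integrable_comp hi.1, ev.integrable_comp hi.2⟩
    · rw [← e2, ev.intervalIntegral_comp_comm hi, ← hE.sub_eq_integral hs hz, map_sub, e, e]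
      rfl
  have hxint : ∀ z, s ≤ z → IntervalIntegrable (fun t => act (A t) (x t)) volume s z ∧
      x z - x s = ∫ t in s..z, act (A t) (x t) := by
    intro z hz
    have hi := (hA.act hxc).intervalIntegrable_Ici hs (hs.trans hz)
    refine ⟨hi, ?_⟩
    refine (intervalIntegral.integral_eq_sub_of_hasDeriv_right_of_le hz
      (hxc.mono fun r hr => hs.trans hr.1)
      (fun r hr => (hx r (hs.trans hr.1.le)).mono fun w hw => ?_) hi).symm
    exact (hs.trans hr.1.le).trans (le_of_lt hw)
  have hg : ContinuousOn (fun t => f * ‖x t - y t‖ + l * ‖act (C t) (x t)‖) (Ici 0) :=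
    (continuousOn_const.mul (hxc.sub hyc).norm).add (continuousOn_const.mul (hC.act hxc).norm)
  have hev : ∀ᶠ z in nhdsWithin s (Ici s),
      f * ‖x z - y z‖ + l * ‖act (C z) (x z)‖ < r := by
    have h := (hg s hs).mono (show Ici s ⊆ Ici 0 from Ici_subset_Ici.2 hs)
    refine h.eventually_lt_const ?_
    simpa [hys] using hr
  obtain ⟨w, hw, hsub⟩ := mem_nhdsGE_iff_exists_Ico_subset.1 hev
  filter_upwards [Ioo_mem_nhdsGT hw] with z hz
  have hz0 : 0 ≤ z := hs.trans hz.1.le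
  have key : x z - y z = ∫ t in s..z, (act (A t) (x t) - act (A t - L t * C t) (y t)) := by
    rw [intervalIntegral.integral_sub (hxint z hz.1.le).1 (hyint z hz0).1,
      ← (hxint z hz.1.le).2, ← (hyint z hz0).2, hys]
    abel
  rw [key, ← abs_of_nonneg (sub_nonneg.2 hz.1.le)]
  refine intervalIntegral.norm_integral_le_of_norm_le_const fun t ht => ?_
  rw [uIoc_of_le hz.1.le] at ht
  have ht0 : 0 ≤ t := hs.trans ht.1.le
  have e3 : act (A t) (x t) - act (A t - L t * C t) (y t) =
      act (A t - L t * C t) (x t - y t) + act (L t) (act (C t) (x t)) := by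
    rw [← act_mul (L t)]
    simp only [act_sub_left, act_sub_right]
    abel
  rw [e3]
  refine ((norm_add_le _ _).trans (add_le_add (norm_act_le_of_le (hf t ht0) _)
    (norm_act_le_of_le (hl t ht0) _))).trans (le_of_lt (hsub ⟨ht.1.le, ht.2.trans_lt hz.2⟩))

/-- The estimate that the variation of constants formula gives for the plant, written as the error
system with input `L C x`. -/
lemma norm_le_of_output_injection (hA : ContinuousOn A (Ici 0)) (hC : ContinuousOn C (Ici 0))
    (hf : ∀ t, 0 ≤ t → ‖A t - L t * C t‖ ≤ f) (hl : ∀ t, 0 ≤ t → ‖L t‖ ≤ l)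
    (hE : IsFundamentalMatrix (fun t => A t - L t * C t) E) (hK0 : 0 < K)
    (hK : ∀ s t, 0 ≤ s → s ≤ t → ‖transition E t s‖ ≤ K)
    (hx : ∀ t, 0 ≤ t → HasDerivWithinAt x (act (A t) (x t)) (Ici 0) t) {t₀ t : ℝ} (ht₀ : 0 ≤ t₀)
    (ht : t₀ ≤ t) :
    ‖x t‖ ≤ K * ‖x t₀‖ + K * l * ∫ s in t₀..t, ‖act (C s) (x s)‖ := by
  have hxc : ContinuousOn x (Ici 0) := fun t ht => (hx t ht).continuousWithinAt
  have hgc : ContinuousOn (fun s => ‖act (C s) (x s)‖) (Ici 0) := (hC.act hxc).norm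
  set J : ℝ → ℝ := fun r => ∫ s in (0 : ℝ)..r, ‖act (C s) (x s)‖ with hJ
  have hJd : ∀ r, 0 ≤ r → HasDerivWithinAt J ‖act (C r) (x r)‖ (Ici 0) r := fun r hr =>
    hasDerivWithinAt_integral_Ici hgc hr
  have ht0 := ht₀.trans ht
  have hJt : ∫ s in t₀..t, ‖act (C s) (x s)‖ = J t - J t₀ :=
    (intervalIntegral.integral_interval_sub_left (hgc.intervalIntegrable_Ici le_rfl ht0)
      (hgc.intervalIntegrable_Ici le_rfl ht₀)).symm
  have hB : ∀ r, 0 ≤ r → HasDerivWithinAt (fun r => K * ‖x t₀‖ + K * l * (J r - J t₀))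
      (K * l * ‖act (C r) (x r)‖) (Ici 0) r := fun r hr =>
    (((hJd r hr).sub_const (J t₀)).const_mul (K * l)).const_add _
  -- `D s` transports `x s` to the final time along the error system
  set D : ℝ → EuclideanSpace ℝ (Fin n) := fun s => act (transition E t s) (x s) with hD
  have hDc : ContinuousOn D (Ici 0) := (continuousOn_const.mul hE.continuousOn_inv).act hxc
  have hsub : Icc t₀ t ⊆ Ici 0 := fun r hr => ht₀.trans hr.1
  have main := image_le_of_liminf_slope_right_le_deriv_boundary (f := fun s => ‖D s‖)
    (a := t₀) (b := t) (B := fun r => K * ‖x t₀‖ + K * l * (J r - J t₀))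
    (B' := fun r => K * l * ‖act (C r) (x r)‖) (hDc.mono hsub).norm
    (by simpa using norm_act_le_of_le (hK t₀ t ht₀ ht) (x t₀))
    (fun r hr => ((hB r (hsub hr)).continuousWithinAt).mono hsub)
    (fun r hr => (hB r (ht₀.trans hr.1)).mono (Ici_subset_Ici.2 (ht₀.trans hr.1)))
    (fun s hs r hr => by
      have hs0 : 0 ≤ s := ht₀.trans hs.1
      obtain ⟨r', hr1, hr2⟩ := exists_between hr
      have hr1' : l * ‖act (C s) (x s)‖ < r' / K := by
        rw [lt_div_iff₀ hK0]; linarith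
      refine Filter.Eventually.frequently ?_
      filter_upwards [eventually_norm_sub_transition_le hA hC hf hl hE hx hs0 hr1',
        Ioo_mem_nhdsGT hs.2] with z hz hz2
      have hzs : 0 < z - s := sub_pos.2 hz2.1
      have hz0 : 0 ≤ z := hs0.trans hz2.1.le
      have e : D z - D s = act (transition E t z) (x z - act (transition E z s) (x s)) := by
        rw [act_sub_right, ← act_mul, hE.transition_mul hz0]
      have h1 : ‖D z - D s‖ ≤ K * (r' / K * (z - s)) := by
        rw [e]
        exact (norm_act_le_of_le (hK z t hz0 hz2.2.le) _).trans
          (mul_le_mul_of_nonneg_left hz hK0.le)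
      rw [← mul_assoc, mul_div_cancel₀ _ hK0.ne'] at h1
      rw [slope_def_field, div_lt_iff₀ hzs]
      calc ‖D z‖ - ‖D s‖ ≤ ‖D z - D s‖ := norm_sub_norm_le _ _
        _ ≤ r' * (z - s) := h1
        _ < r * (z - s) := mul_lt_mul_of_pos_right hr2 hzs)
  have := main (right_mem_Icc.2 ht)
  rw [hJt]
  simpa only [hD, hE.transition_self ht0, act_one] using this

end Variation

/-! ### Detectability implies observability -/

/-- The inequality `2 g ≤ ε + g² / ε`, integrated. It bounds the integral of the output norm by the
output energy, in place of the Cauchy–Schwarz inequality. -/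
lemma two_mul_integral_le {g : ℝ → ℝ} (hg : ContinuousOn g (Ici 0)) {a b ε : ℝ} (ha : 0 ≤ a)
    (hab : a ≤ b) (hε : 0 < ε) :
    2 * ∫ s in a..b, g s ≤ ε * (b - a) + (∫ s in a..b, g s ^ 2) / ε := by
  have hb := ha.trans hab
  have h1 : IntervalIntegrable (fun s => g s ^ 2) volume a b :=
    (hg.pow 2).intervalIntegrable_Ici ha hb
  have h : ∫ s in a..b, 2 * g s ≤ ∫ s in a..b, (ε + g s ^ 2 / ε) := by
    refine intervalIntegral.integral_mono_on hab
      ((hg.intervalIntegrable_Ici ha hb).const_mul 2)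
      (intervalIntegrable_const.add (h1.div_const ε)) fun s _ => ?_
    have : ε + g s ^ 2 / ε - 2 * g s = (ε - g s) ^ 2 / ε := by field_simp; ring
    have h0 : 0 ≤ (ε - g s) ^ 2 / ε := by positivity
    linarith
  rw [intervalIntegral.integral_const_mul, intervalIntegral.integral_add intervalIntegrable_const
    (h1.div_const ε), intervalIntegral.integral_div, intervalIntegral.integral_const,
    smul_eq_mul, mul_comm (b - a)] at h
  exact h

lemma inner_act_observabilityGramian {n p : ℕ} {A X : ℝ → Matrix (Fin n) (Fin n) ℝ}
    {C : ℝ → Matrix (Fin p) (Fin n) ℝ} (hX : IsFundamentalMatrix A X)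
    (hC : ContinuousOn C (Ici 0)) {t₀ t₁ : ℝ} (h₀ : 0 ≤ t₀) (h₁ : 0 ≤ t₁)
    (v : EuclideanSpace ℝ (Fin n)) :
    inner ℝ v (act (observabilityGramian X C t₁ t₀) v) =
      ∫ s in t₀..t₁, ‖act (C s) (act (transition X s t₀) v)‖ ^ 2 :=
  inner_act_integral_gram (hX.continuousOn_transition t₀) hC h₀ h₁ v

lemma inner_act_smul_one {n : ℕ} (c : ℝ) (v : EuclideanSpace ℝ (Fin n)) :
    inner ℝ v (act (c • (1 : Matrix (Fin n) (Fin n) ℝ)) v) = c * ‖v‖ ^ 2 := by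
  have h : act (c • (1 : Matrix (Fin n) (Fin n) ℝ)) v = c • v := by
    simp [act_eq, Matrix.smul_mulVec]
  rw [h, inner_smul_right, real_inner_self_eq_norm_sq]

theorem uniformlyCompletelyObservable_of_detectable {n p : ℕ}
    {A X : ℝ → Matrix (Fin n) (Fin n) ℝ} {C : ℝ → Matrix (Fin p) (Fin n) ℝ} {a c K α : ℝ}
    (hA : ContinuousOn A (Ici 0)) (ha : ∀ t, 0 ≤ t → ‖A t‖ ≤ a)
    (hC : ContinuousOn C (Ici 0)) (hc : ∀ t, 0 ≤ t → ‖C t‖ ≤ c)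
    (hX : IsFundamentalMatrix A X) (hK : 1 ≤ K) (hα : 0 < α)
    (hXK : ∀ t t₀, 0 ≤ t → t ≤ t₀ → ‖transition X t t₀‖ ≤ K * Real.exp (α * (t - t₀)))
    (hdet : UniformlyExponentiallyDetectable A C) : UniformlyCompletelyObservable A C := by
  obtain ⟨L, -, ⟨l₀, hl₀⟩, E, hE, Kₑ, μ, hKₑ, hμ, hEK⟩ := hdet
  have hKₑ0 : 0 < Kₑ := by linarith
  have hK0 : 0 < K := by linarith
  have ha0 : 0 ≤ a := (norm_nonneg _).trans (ha 0 le_rfl)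
  have hc0 : 0 ≤ c := (norm_nonneg _).trans (hc 0 le_rfl)
  obtain ⟨l, hl1, hl⟩ : ∃ l : ℝ, 0 < l ∧ ∀ t, 0 ≤ t → ‖L t‖ ≤ l :=
    ⟨max l₀ 1, by positivity, fun t ht => (hl₀ t ht).trans (le_max_left _ _)⟩
  have hf : ∀ t, 0 ≤ t → ‖A t - L t * C t‖ ≤ a + l * c := fun t ht =>
    (norm_sub_le _ _).trans (add_le_add (ha t ht) ((Matrix.l2_opNorm_mul _ _).trans
      (mul_le_mul (hl t ht) (hc t ht) (norm_nonneg _) hl1.le)))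
  have hEK' : ∀ s t, 0 ≤ s → s ≤ t → ‖transition E t s‖ ≤ Kₑ := fun s t hs hst =>
    (hEK s t hs hst).trans (mul_le_of_le_one_right hKₑ0.le
      (Real.exp_le_one_iff.2 (by nlinarith [sub_nonneg.2 hst])))
  -- after time `σ`, every solution of the plant has grown by the factor `Kₑ + 1` at least
  obtain ⟨σ, hσ, hσK⟩ : ∃ σ : ℝ, 0 < σ ∧ K * Real.exp (-(α * σ)) * (Kₑ + 1) ≤ 1 := by
    refine ⟨K * (Kₑ + 1) / α, by positivity, ?_⟩
    rw [mul_div_cancel₀ _ hα.ne', Real.exp_neg, mul_right_comm, ← div_eq_mul_inv,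
      div_le_one (Real.exp_pos _)]
    linarith [Real.add_one_le_exp (K * (Kₑ + 1))]
  set k := Kₑ * l with hk
  have hk0 : 0 < k := by positivity
  refine ⟨X, hX, 1 / (k ^ 2 * σ), σ * (c * Real.exp (a * σ)) ^ 2 + 1, σ, by positivity,
    by positivity, hσ, fun t₀ ht₀ => ?_⟩
  have ht₁ : 0 ≤ t₀ + σ := by linarith
  have hsymm : (observabilityGramian X C (t₀ + σ) t₀)ᵀ = observabilityGramian X C (t₀ + σ) t₀ :=
    transpose_integral_gram (hX.continuousOn_transition t₀) hC ht₀ ht₁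
  have hcont : ∀ v, ContinuousOn (fun s => ‖act (C s) (act (transition X s t₀) v)‖) (Ici 0) :=
    fun v => (hC.act ((hX.continuousOn_transition t₀).act continuousOn_const)).norm
  constructor
  · refine posSemidef_of_inner_nonneg (by simp [hsymm]) fun v => ?_
    rw [act_sub_left, inner_sub_right, inner_act_smul_one,
      inner_act_observabilityGramian hX hC ht₀ ht₁, sub_nonneg]
    set q := ∫ s in t₀..t₀ + σ, ‖act (C s) (act (transition X s t₀) v)‖ ^ 2 with hq
    have hx : ∀ t, 0 ≤ t → HasDerivWithinAt (fun t => act (transition X t t₀) v)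
        (act (A t) (act (transition X t t₀) v)) (Ici 0) t := fun t ht => by
      have h := ((mulVecBilin n n).flip v).hasFDerivAt.comp_hasDerivWithinAt t
        ((hX.hasDerivWithinAt hA ht).mul_const ((X t₀)⁻¹))
      rw [← act_mul, transition, ← Matrix.mul_assoc]
      exact h
    have h1 := norm_le_of_output_injection hA hC hf hl hE hKₑ0 hEK' hx ht₀
      (show t₀ ≤ t₀ + σ by linarith)
    simp only [hX.transition_self ht₀, act_one] at h1
    set I := ∫ s in t₀..t₀ + σ, ‖act (C s) (act (transition X s t₀) v)‖ with hI
    have h2 : (Kₑ + 1) * ‖v‖ ≤ ‖act (transition X (t₀ + σ) t₀) v‖ := by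
      have h3 := norm_act_le_of_le (hXK t₀ (t₀ + σ) ht₀ (by linarith))
        (act (transition X (t₀ + σ) t₀) v)
      rw [← act_mul, hX.transition_mul ht₁, hX.transition_self ht₀, act_one,
        show α * (t₀ - (t₀ + σ)) = -(α * σ) by ring] at h3
      calc (Kₑ + 1) * ‖v‖ ≤ (Kₑ + 1) * (K * Real.exp (-(α * σ)) *
            ‖act (transition X (t₀ + σ) t₀) v‖) := by gcongr
        _ = K * Real.exp (-(α * σ)) * (Kₑ + 1) * ‖act (transition X (t₀ + σ) t₀) v‖ := by ring
        _ ≤ _ := mul_le_of_le_one_left (norm_nonneg _) hσK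
    have h4 : ‖v‖ ≤ k * I := by linarith
    rcases (norm_nonneg v).eq_or_lt with hv | hv
    · rw [← hv]
      simpa using intervalIntegral.integral_nonneg (by linarith : t₀ ≤ t₀ + σ)
        fun s _ => sq_nonneg ‖act (C s) (act (transition X s t₀) v)‖
    · -- with this `ε` the first term on the right is `‖v‖ / k`, half of the bound `2 I ≥ 2 ‖v‖ / k`
      have h5 := two_mul_integral_le (hcont v) ht₀ (by linarith : t₀ ≤ t₀ + σ)
        (ε := ‖v‖ / (k * σ)) (by positivity)
      rw [add_sub_cancel_left, ← hI, ← hq] at h5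
      have h6 : k * (2 * I) ≤ ‖v‖ + k ^ 2 * σ * q / ‖v‖ := by
        refine (mul_le_mul_of_nonneg_left h5 hk0.le).trans (le_of_eq ?_)
        field_simp
      have h7 : ‖v‖ ≤ k ^ 2 * σ * q / ‖v‖ := by linarith
      rw [le_div_iff₀ hv] at h7
      rw [one_div_mul_eq_div, div_le_iff₀ (by positivity)]
      linarith
  · refine posSemidef_of_inner_nonneg (by simp [hsymm]) fun v => ?_
    rw [act_sub_left, inner_sub_right, inner_act_smul_one,
      inner_act_observabilityGramian hX hC ht₀ ht₁, sub_nonneg]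
    have hb : ∫ s in t₀..t₀ + σ, ‖act (C s) (act (transition X s t₀) v)‖ ^ 2 ≤
        ∫ _ in t₀..t₀ + σ, (c * Real.exp (a * σ) * ‖v‖) ^ 2 := by
      refine intervalIntegral.integral_mono_on (by linarith)
        (((hcont v).pow 2).intervalIntegrable_Ici ht₀ ht₁) intervalIntegrable_const fun s hs => ?_
      have hs0 := ht₀.trans hs.1
      gcongr
      rw [mul_assoc]
      refine (norm_act_le_of_le (hc s hs0) _).trans (mul_le_mul_of_nonneg_left ?_ hc0)
      refine norm_act_le_of_le ((hX.norm_transition_le hA ha ht₀ hs.1).trans ?_) _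
      gcongr
      linarith [hs.2]
    rw [intervalIntegral.integral_const, smul_eq_mul, add_sub_cancel_left] at hb
    nlinarith [sq_nonneg ‖v‖]

/-! ### Observability implies detectability -/

lemma isUnit_and_norm_inv_le_of_coercive {n : ℕ} {M : Matrix (Fin n) (Fin n) ℝ} {c : ℝ}
    (hc : 0 < c) (h : ∀ v, c * ‖v‖ ^ 2 ≤ inner ℝ v (act M v)) : IsUnit M ∧ ‖M⁻¹‖ ≤ 1 / c := by
  have h1 : ∀ v, c * ‖v‖ ≤ ‖act M v‖ := fun v => by
    rcases (norm_nonneg v).eq_or_lt with hv | hv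
    · rw [← hv, mul_zero]; exact norm_nonneg _
    · have := (h v).trans (real_inner_le_norm _ _)
      rw [pow_two, ← mul_assoc, mul_comm ‖v‖ ‖act M v‖] at this
      exact le_of_mul_le_mul_right this hv
  have hu : IsUnit M := by
    rw [← Matrix.mulVec_injective_iff_isUnit, ← Matrix.coe_mulVecLin,
      injective_iff_map_eq_zero]
    intro x hx
    have h2 := h1 (WithLp.toLp 2 x)
    have h3 : act M (WithLp.toLp 2 x) = 0 := by
      rw [act_eq]
      simpa using hx
    rw [h3, norm_zero] at h2
    have h4 : ‖(WithLp.toLp 2 x : EuclideanSpace ℝ (Fin n))‖ ≤ 0 := by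
      by_contra h5
      exact absurd (mul_pos hc (not_le.1 h5)) (not_lt.2 h2)
    simpa using norm_le_zero_iff.1 h4
  refine ⟨hu, opNorm_le_of_norm_act_le (by positivity) fun v => ?_⟩
  have h2 := h1 (act M⁻¹ v)
  rw [← act_mul, mul_inv_self_of_isUnit hu, act_one] at h2
  rw [one_div_mul_eq_div, le_div_iff₀ hc]
  linarith

lemma inner_act_congruence {n : ℕ} (N M : Matrix (Fin n) (Fin n) ℝ)
    (v : EuclideanSpace ℝ (Fin n)) :
    inner ℝ v (act (Nᵀ * M * N) v) = inner ℝ (act N v) (act M (act N v)) := by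
  rw [act_mul, act_mul]
  simp only [EuclideanSpace.inner_eq_star_dotProduct, act_eq, star_trivial]
  rw [Matrix.mulVec_transpose, ← Matrix.dotProduct_mulVec]

lemma integral_exp_le {α t : ℝ} (hα : 0 < α) :
    ∫ s in (0 : ℝ)..t, Real.exp (α * (s - t)) ≤ 1 / α := by
  have h : ∀ s ∈ uIcc 0 t, HasDerivAt (fun s => Real.exp (α * (s - t)) / α)
      (Real.exp (α * (s - t))) s := fun s _ => by
    have := ((((hasDerivAt_id s).sub_const t).const_mul α).exp).div_const α
    simpa [hα.ne'] using this
  rw [intervalIntegral.integral_eq_sub_of_hasDerivAt h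
    (Continuous.intervalIntegrable (by fun_prop) _ _)]
  have : 0 ≤ Real.exp (α * (0 - t)) / α := by positivity
  simp only [sub_self, mul_zero, Real.exp_zero]
  linarith

/-- The Gramian of the outputs on `[0, t]` in the coordinates `x = X z`. The term `X(0)ᵀ X(0)`
keeps it nonsingular while `t` is still shorter than the observation window. -/
noncomputable def anchoredGramian {n p : ℕ} (X : ℝ → Matrix (Fin n) (Fin n) ℝ)
    (C : ℝ → Matrix (Fin p) (Fin n) ℝ) (t : ℝ) : Matrix (Fin n) (Fin n) ℝ :=
  (X 0)ᵀ * X 0 + ∫ s in (0 : ℝ)..t, (X s)ᵀ * (C s)ᵀ * C s * X s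

/-- The anchored Gramian in the coordinates of the state at time `t`. It is the matrix
`W(t) = Φ(0, t)ᵀ Φ(0, t) + ∫₀ᵗ Φ(s, t)ᵀ C(s)ᵀ C(s) Φ(s, t) ds`. -/
noncomputable def backwardGramian {n p : ℕ} (X : ℝ → Matrix (Fin n) (Fin n) ℝ)
    (C : ℝ → Matrix (Fin p) (Fin n) ℝ) (t : ℝ) : Matrix (Fin n) (Fin n) ℝ :=
  ((X t)⁻¹)ᵀ * anchoredGramian X C t * (X t)⁻¹

section Observer

variable {n p : ℕ} {A X : ℝ → Matrix (Fin n) (Fin n) ℝ} {C : ℝ → Matrix (Fin p) (Fin n) ℝ}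

lemma hasDerivWithinAt_anchoredGramian (hX : ContinuousOn X (Ici 0)) (hC : ContinuousOn C (Ici 0))
    {t : ℝ} (ht : 0 ≤ t) : HasDerivWithinAt (anchoredGramian X C)
      ((X t)ᵀ * (C t)ᵀ * C t * X t) (Ici 0) t :=
  (hasDerivWithinAt_integral_Ici (continuousOn_gram hX hC) ht).const_add _

lemma inner_act_anchoredGramian (hX : ContinuousOn X (Ici 0)) (hC : ContinuousOn C (Ici 0))
    {t : ℝ} (ht : 0 ≤ t) (v : EuclideanSpace ℝ (Fin n)) :
    inner ℝ v (act (anchoredGramian X C t) v) =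
      ‖act (X 0) v‖ ^ 2 + ∫ s in (0 : ℝ)..t, ‖act (C s) (act (X s) v)‖ ^ 2 := by
  rw [← inner_act_integral_gram hX hC le_rfl ht, ← inner_act_transpose_mul_self, ← inner_add_right]
  congr 1
  simp [act, anchoredGramian]

/-- Uniform observability bounds the backward Gramian from below: through its last observation
window once `t ≥ σ`, and through the term that anchors it at time `0` before. -/
lemma backwardGramian_coercive {a β σ : ℝ} (hX : IsFundamentalMatrix A X)
    (hA : ContinuousOn A (Ici 0)) (ha : ∀ t, 0 ≤ t → ‖A t‖ ≤ a) (hC : ContinuousOn C (Ici 0))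
    (hβ : 0 < β) (hσ : 0 < σ)
    (hobs : ∀ t₀, 0 ≤ t₀ → (observabilityGramian X C (t₀ + σ) t₀ - β • 1).PosSemidef)
    {t : ℝ} (ht : 0 ≤ t) (v : EuclideanSpace ℝ (Fin n)) :
    min β 1 / Real.exp (a * σ) ^ 2 * ‖v‖ ^ 2 ≤ inner ℝ v (act (backwardGramian X C t) v) := by
  have ha0 : 0 ≤ a := (norm_nonneg _).trans (ha 0 le_rfl)
  rw [backwardGramian, inner_act_congruence,
    inner_act_anchoredGramian hX.continuousOn hC ht]
  set z := act (X t)⁻¹ v with hz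
  have hv : v = act (X t) z := by
    rw [hz, ← act_mul, mul_inv_self_of_isUnit (hX t ht).1, act_one]
  have hcont : ContinuousOn (fun s => ‖act (C s) (act (X s) z)‖ ^ 2) (Ici 0) :=
    (hC.act (hX.continuousOn.act continuousOn_const)).norm.pow 2
  have hint : ∀ r s, 0 ≤ r → r ≤ s →
      0 ≤ ∫ s in r..s, ‖act (C s) (act (X s) z)‖ ^ 2 := fun r s _ hrs =>
    intervalIntegral.integral_nonneg hrs fun _ _ => sq_nonneg _
  -- the state at most `σ` before `t` is not much smaller than the state at time `t`
  have hgrow : ∀ s, 0 ≤ s → s ≤ t → t ≤ s + σ →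
      ‖v‖ ^ 2 / Real.exp (a * σ) ^ 2 ≤ ‖act (X s) z‖ ^ 2 := by
    intro s hs hst hts
    rw [← div_pow]
    gcongr
    rw [div_le_iff₀ (Real.exp_pos _), hv, ← hX.transition_mul_self hs, act_mul, mul_comm]
    refine norm_act_le_of_le ((hX.norm_transition_le hA ha hs hst).trans ?_) _
    gcongr
    linarith
  have e : min β 1 / Real.exp (a * σ) ^ 2 * ‖v‖ ^ 2 =
      min β 1 * (‖v‖ ^ 2 / Real.exp (a * σ) ^ 2) := by ring
  have hq : 0 ≤ ‖v‖ ^ 2 / Real.exp (a * σ) ^ 2 := by positivity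
  rw [e]
  rcases le_total t σ with htσ | htσ
  · have h1 := hgrow 0 le_rfl ht (by linarith)
    have h2 := mul_le_mul_of_nonneg_right (min_le_right β 1) hq
    linarith [hint 0 t le_rfl ht]
  · have hs : 0 ≤ t - σ := sub_nonneg.2 htσ
    have h1 := hgrow (t - σ) hs (by linarith) (by linarith)
    have h2 := mul_le_mul_of_nonneg_right (min_le_left β 1) hq
    have h3 := inner_act_nonneg (hobs (t - σ) hs) (act (X (t - σ)) z)
    rw [sub_add_cancel, act_sub_left, inner_sub_right, inner_act_smul_one,
      inner_act_observabilityGramian hX hC hs ht] at h3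
    simp only [← act_mul (transition _ _ _), hX.transition_mul_self hs] at h3
    have h4 := intervalIntegral.integral_add_adjacent_intervals
      (hcont.intervalIntegrable_Ici le_rfl hs) (hcont.intervalIntegrable_Ici hs ht)
    have h5 := mul_le_mul_of_nonneg_left h1 hβ.le
    linarith [hint 0 (t - σ) le_rfl hs, sq_nonneg ‖act (X 0) z‖]

/-- Anti-stability bounds the backward Gramian from above. -/
lemma norm_backwardGramian_le {c K α : ℝ} (hX : IsFundamentalMatrix A X)
    (hC : ContinuousOn C (Ici 0)) (hc : ∀ t, 0 ≤ t → ‖C t‖ ≤ c) (hα : 0 < α) (hK : 0 ≤ K)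
    (hXK : ∀ t t₀, 0 ≤ t → t ≤ t₀ → ‖transition X t t₀‖ ≤ K * Real.exp (α * (t - t₀)))
    {t : ℝ} (ht : 0 ≤ t) : ‖backwardGramian X C t‖ ≤ K ^ 2 + K ^ 2 * c ^ 2 * (1 / (2 * α)) := by
  have hc0 : 0 ≤ c := (norm_nonneg _).trans (hc 0 le_rfl)
  have e : backwardGramian X C t = (transition X 0 t)ᵀ * transition X 0 t +
      ∫ s in (0 : ℝ)..t, (transition X s t)ᵀ * (C s)ᵀ * C s * transition X s t := by
    have h := (ContinuousLinearMap.mulLeftRight ℝ (Matrix (Fin n) (Fin n) ℝ) ((X t)⁻¹)ᵀ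
      (X t)⁻¹).intervalIntegral_comp_comm
        ((continuousOn_gram hX.continuousOn hC).intervalIntegrable_Ici le_rfl ht)
    simp only [ContinuousLinearMap.mulLeftRight_apply] at h
    rw [backwardGramian, anchoredGramian, Matrix.mul_add, Matrix.add_mul, ← h]
    simp only [transition, Matrix.transpose_mul, Matrix.mul_assoc]
  rw [e]
  have h0 : ‖(transition X 0 t)ᵀ * transition X 0 t‖ ≤ K ^ 2 := by
    have h1 : ‖transition X 0 t‖ ≤ K := (hXK 0 t le_rfl ht).trans
      (mul_le_of_le_one_right hK (Real.exp_le_one_iff.2 (by nlinarith)))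
    refine (norm_mul_le _ _).trans ?_
    rw [norm_transpose, ← pow_two]
    gcongr
  have h2 : ‖∫ s in (0 : ℝ)..t, (transition X s t)ᵀ * (C s)ᵀ * C s * transition X s t‖ ≤
      ∫ s in (0 : ℝ)..t, K ^ 2 * c ^ 2 * Real.exp (2 * α * (s - t)) := by
    refine intervalIntegral.norm_integral_le_of_norm_le ht (.of_forall fun s hs => ?_)
      (Continuous.intervalIntegrable (by fun_prop) _ _)
    have h3 := hXK s t hs.1.le hs.2
    have h4 := hc s hs.1.le
    have h5 : ‖C s * transition X s t‖ ≤ c * (K * Real.exp (α * (s - t))) :=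
      (Matrix.l2_opNorm_mul _ _).trans (mul_le_mul h4 h3 (norm_nonneg _) hc0)
    rw [Matrix.mul_assoc, ← Matrix.transpose_mul]
    refine (Matrix.l2_opNorm_mul _ _).trans ?_
    rw [norm_transpose, ← pow_two]
    refine (pow_le_pow_left₀ (norm_nonneg _) h5 2).trans (le_of_eq ?_)
    rw [mul_pow, mul_pow, ← Real.exp_nat_mul]
    push_cast
    ring_nf
  rw [intervalIntegral.integral_const_mul] at h2
  refine (norm_add_le _ _).trans (add_le_add h0 (h2.trans ?_))
  gcongr
  exact integral_exp_le (by positivity)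

theorem uniformlyExponentiallyDetectable_of_observable {a c K α β σ : ℝ}
    (hA : ContinuousOn A (Ici 0)) (ha : ∀ t, 0 ≤ t → ‖A t‖ ≤ a)
    (hC : ContinuousOn C (Ici 0)) (hc : ∀ t, 0 ≤ t → ‖C t‖ ≤ c)
    (hX : IsFundamentalMatrix A X) (hK : 1 ≤ K) (hα : 0 < α)
    (hXK : ∀ t t₀, 0 ≤ t → t ≤ t₀ → ‖transition X t t₀‖ ≤ K * Real.exp (α * (t - t₀)))
    (hβ : 0 < β) (hσ : 0 < σ)
    (hobs : ∀ t₀, 0 ≤ t₀ → (observabilityGramian X C (t₀ + σ) t₀ - β • 1).PosSemidef) :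
    UniformlyExponentiallyDetectable A C := by
  set G := anchoredGramian X C with hG
  set W := backwardGramian X C with hW
  obtain ⟨b, hb0, hb⟩ : ∃ b : ℝ, 0 ≤ b ∧ ∀ t, 0 ≤ t → IsUnit (W t) ∧ ‖(W t)⁻¹‖ ≤ b :=
    ⟨1 / (min β 1 / Real.exp (a * σ) ^ 2), by positivity, fun t ht =>
      isUnit_and_norm_inv_le_of_coercive (by positivity)
        (backwardGramian_coercive hX hA ha hC hβ hσ hobs ht)⟩
  obtain ⟨d, hd0, hd⟩ : ∃ d : ℝ, 0 ≤ d ∧ ∀ t, 0 ≤ t → ‖W t‖ ≤ d :=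
    ⟨K ^ 2 + K ^ 2 * c ^ 2 * (1 / (2 * α)), by positivity, fun t ht =>
      norm_backwardGramian_le hX hC hc hα (by linarith) hXK ht⟩
  have hXu : ∀ t, 0 ≤ t → IsUnit (X t) := fun t ht => (hX t ht).1
  have hGW : ∀ t, 0 ≤ t → G t = (X t)ᵀ * W t * X t := fun t ht => by
    have h1 := inv_mul_self_of_isUnit (hXu t ht)
    have h2 : (X t)ᵀ * ((X t)⁻¹)ᵀ = 1 := by
      rw [← Matrix.transpose_mul, h1, Matrix.transpose_one]
    calc G t = (X t)ᵀ * ((X t)⁻¹)ᵀ * G t * ((X t)⁻¹ * X t) := by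
          rw [h1, h2, Matrix.one_mul, Matrix.mul_one]
      _ = _ := by simp only [hW, hG, backwardGramian, Matrix.mul_assoc]
  have hGu : ∀ t, 0 ≤ t → IsUnit (G t) := fun t ht => by
    rw [hGW t ht]
    exact (((Matrix.isUnit_transpose _).2 (hXu t ht)).mul (hb t ht).1).mul (hXu t ht)
  have hWinv : ∀ t, 0 ≤ t → (W t)⁻¹ = X t * (G t)⁻¹ * (X t)ᵀ := fun t ht => by
    refine Matrix.inv_eq_left_inv ?_
    have h1 : (X t)ᵀ * W t = G t * (X t)⁻¹ := by
      rw [hGW t ht, Matrix.mul_assoc, mul_inv_self_of_isUnit (hXu t ht), Matrix.mul_one]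
    rw [Matrix.mul_assoc, h1, Matrix.mul_assoc, ← Matrix.mul_assoc (G t)⁻¹,
      inv_mul_self_of_isUnit (hGu t ht), Matrix.one_mul, mul_inv_self_of_isUnit (hXu t ht)]
  have hGd : ∀ t, 0 ≤ t → HasDerivWithinAt G ((X t)ᵀ * (C t)ᵀ * C t * X t) (Ici 0) t :=
    fun t ht => hasDerivWithinAt_anchoredGramian hX.continuousOn hC ht
  have hGi : ContinuousOn (fun t => (G t)⁻¹) (Ici 0) :=
    continuousOn_matrix_inv (fun t ht => (hGd t ht).continuousWithinAt) hGu
  have hLc : ContinuousOn (fun t => X t * (G t)⁻¹ * (X t)ᵀ * (C t)ᵀ) (Ici 0) :=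
    ((hX.continuousOn.mul hGi).mul hX.continuousOn.matrix_transpose_on).matrix_mul_rect
      hC.matrix_transpose_on
  have hE : IsFundamentalMatrix (fun t => A t - X t * (G t)⁻¹ * (X t)ᵀ * (C t)ᵀ * C t)
      (fun t => X t * (G t)⁻¹) := by
    refine isFundamentalMatrix_of_hasDerivWithinAt (hA.sub (hLc.matrix_mul_rect hC))
      (fun t ht => (hXu t ht).mul (Matrix.isUnit_nonsing_inv_iff.2 (hGu t ht))) fun t ht => ?_
    have h := (hX.hasDerivWithinAt hA ht).mul (hasDerivWithinAt_matrix_inv (hGd t ht) (hGu t ht))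
    convert! h using 1
    rw [Matrix.sub_mul, Matrix.mul_neg, sub_eq_add_neg]
    simp only [Matrix.mul_assoc]
  refine ⟨fun t => X t * (G t)⁻¹ * (X t)ᵀ * (C t)ᵀ,
    hLc.aestronglyMeasurable measurableSet_Ici, ⟨b * c, fun t ht => ?_⟩,
    fun t => X t * (G t)⁻¹, hE, max 1 (b * K * d), α, le_max_left _ _, hα,
    fun t₀ t ht₀ ht => ?_⟩
  · beta_reduce
    rw [← hWinv t ht]
    refine (Matrix.l2_opNorm_mul _ _).trans ?_
    rw [norm_transpose]
    exact mul_le_mul (hb t ht).2 (hc t ht) (norm_nonneg _) hb0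
  · have ht' := ht₀.trans ht
    -- in the coordinates `W e` the error obeys the adjoint equation of the plant
    have e : transition (fun t => X t * (G t)⁻¹) t t₀ =
        (W t)⁻¹ * (transition X t₀ t)ᵀ * W t₀ := by
      have h2 : (X t)ᵀ * ((X t)⁻¹)ᵀ = 1 := by
        rw [← Matrix.transpose_mul, inv_mul_self_of_isUnit (hXu t ht'), Matrix.transpose_one]
      have h3 : (X t₀)ᵀ * W t₀ = G t₀ * (X t₀)⁻¹ := by
        rw [hGW t₀ ht₀, Matrix.mul_assoc, mul_inv_self_of_isUnit (hXu t₀ ht₀), Matrix.mul_one]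
      rw [hWinv t ht', transition, transition, Matrix.transpose_mul, Matrix.mul_inv_rev,
        Matrix.nonsing_inv_nonsing_inv _ ((Matrix.isUnit_iff_isUnit_det _).1 (hGu t₀ ht₀))]
      calc X t * (G t)⁻¹ * (G t₀ * (X t₀)⁻¹)
          = X t * (G t)⁻¹ * ((X t)ᵀ * ((X t)⁻¹)ᵀ) * ((X t₀)ᵀ * W t₀) := by
            rw [h2, h3, Matrix.mul_one]
        _ = _ := by simp only [Matrix.mul_assoc]
    rw [e]
    have h1 : ‖(W t)⁻¹ * (transition X t₀ t)ᵀ * W t₀‖ ≤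
        b * (K * Real.exp (α * (t₀ - t))) * d := by
      refine (norm_mul_le _ _).trans (mul_le_mul ((norm_mul_le _ _).trans ?_) (hd t₀ ht₀)
        (norm_nonneg _) (by positivity))
      rw [norm_transpose]
      exact mul_le_mul (hb t ht').2 (hXK t₀ t ht₀ ht) (norm_nonneg _) hb0
    calc _ ≤ b * (K * Real.exp (α * (t₀ - t))) * d := h1
      _ = b * K * d * Real.exp (-α * (t - t₀)) := by
        rw [show α * (t₀ - t) = -α * (t - t₀) by ring]; ring
      _ ≤ _ := by gcongr; exact le_max_right _ _

end Observer

end LTV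

theorem proposition1 {n p : ℕ} (A : ℝ → Matrix (Fin n) (Fin n) ℝ)
    (C : ℝ → Matrix (Fin p) (Fin n) ℝ)
    (hA_cont : ContinuousOn A (Ici 0)) (hA_bdd : LTV.UniformlyBounded A)
    (hC_cont : ContinuousOn C (Ici 0)) (hC_bdd : LTV.UniformlyBounded C)
    (hED : LTV.HasExponentialDichotomy A 0) :
    LTV.UniformlyExponentiallyDetectable A C ↔ LTV.UniformlyCompletelyObservable A C := by
  obtain ⟨a, ha⟩ := hA_bdd
  obtain ⟨c, hc⟩ := hC_bdd
  obtain ⟨-, X, hX, K, α, hK, hα, -, hXK⟩ := hED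
  simp only [sub_zero, Matrix.mul_one] at hXK
  refine ⟨LTV.uniformlyCompletelyObservable_of_detectable hA_cont ha hC_cont hc hX hK hα hXK, ?_⟩
  rintro ⟨Y, hY, β₁, β₂, σ, hβ₁, -, hσ, hobs⟩
  refine LTV.uniformlyExponentiallyDetectable_of_observable hA_cont ha hC_cont hc hX hK hα hXK
    hβ₁ hσ fun t₀ ht₀ => ?_
  have e : LTV.observabilityGramian X C (t₀ + σ) t₀ =
      LTV.observabilityGramian Y C (t₀ + σ) t₀ := by
    refine intervalIntegral.integral_congr fun s hs => ?_
    rw [uIcc_of_le (by linarith)] at hs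
    simp only [hX.transition_eq hY hA_cont ha ht₀ hs.1]
  rw [e]
  exact (hobs t₀ ht₀).1
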